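/- Let $\mathcal{I}$ be the category with objects the finite sets $\mathbf{n}=\{1,\dots,n\}$, $n\ge 0$, and morphisms the injections. It is symmetric monoidal under concatenation $\sqcup$, with the block shuffles as symmetry isomorphisms. Let $\mathrm{sSet}^{\mathcal{I}}$ be the category of functors $\mathcal{I}\to\mathrm{sSet}$, with the symmetric monoidal product $\boxtimes$ in which $X\boxtimes Y$ is the left Kan extension of $(\mathbf{k},\mathbf{l})\mapsto X(\mathbf{k})\times Y(\mathbf{l})$ along $\sqcup\colon\mathcal{I}\times\mathcal{I}\to\mathcal{I}$. Equip $\mathrm{sSet}$ with the Joyal model structure. Call an object $X$ of $\mathrm{sSet}^{\mathcal{I}}$ positive $\mathcal{I}$-cofibrant if the map $\emptyset\to X$ has the left lifting property with respect to every map $f$ in $\mathrm{sSet}^{\mathcal{I}}$ such that $f(\mathbf{n})$ is both a fibration and a weak equivalence in the Joyal model structure for all $n\ge 1$. Let $X$ be positive $\mathcal{I}$-cofibrant. Then for every $n\ge 0$ and every object $\mathbf{m}$ of $\mathcal{I}$, the action of the symmetric group $\Sigma_n$ on the simplicial set $(X^{\boxtimes n})(\mathbf{m})$ by permuting the factors through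 the symmetry isomorphisms of $\boxtimes$ is free, that is, if $\sigma\in\Sigma_n$ fixes some simplex of $(X^{\boxtimes n})(\mathbf{m})$, then $\sigma$ is the identity. -/

import Mathlib

open CategoryTheory MonoidalCategory Limits

universe v₁ v₂ u₁ u₂ v w u

/-! ## The category of finite sets and injections -/

/-- The category of the finite sets `{1, …, n}` (here `Fin n`), `n ≥ 0`, and injections. -/
structure InjCat : Type where
  card : ℕ

namespace InjCat

instance : Category.{0} InjCat where
  Hom a b := Fin a.card ↪ Fin b.card
  id a := Function.Embedding.refl _
  comp f g := f.trans g

/-- A bijection as an isomorphism of `InjCat`. -/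
def isoOfEquiv {a b : InjCat} (e : Fin a.card ≃ Fin b.card) : a ≅ b where
  hom := e.toEmbedding
  inv := e.symm.toEmbedding
  hom_inv_id := Function.Embedding.ext e.symm_apply_apply
  inv_hom_id := Function.Embedding.ext e.apply_symm_apply

/-- The concatenation of two injections. -/
def concat {a a' b b' : ℕ} (f : Fin a ↪ Fin a') (g : Fin b ↪ Fin b') :
    Fin (a + b) ↪ Fin (a' + b') :=
  finSumFinEquiv.symm.toEmbedding.trans ((f.sumMap g).trans finSumFinEquiv.toEmbedding)

@[simp] lemma concat_castAdd {a a' b b' : ℕ} (f : Fin a ↪ Fin a') (g : Fin b ↪ Fin b')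
    (i : Fin a) : concat f g (Fin.castAdd b i) = Fin.castAdd b' (f i) := by
  simp [concat]

@[simp] lemma concat_natAdd {a a' b b' : ℕ} (f : Fin a ↪ Fin a') (g : Fin b ↪ Fin b')
    (i : Fin b) : concat f g (Fin.natAdd a i) = Fin.natAdd a' (g i) := by
  simp [concat]

/-- Concatenation of ordered sets; the associator and the unitors are the order-preserving
bijections. -/
instance : MonoidalCategoryStruct InjCat where
  tensorObj a b := ⟨a.card + b.card⟩
  tensorHom f g := concat f g
  whiskerLeft a _ _ f := concat (Function.Embedding.refl (Fin a.card)) f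
  whiskerRight f b := concat f (Function.Embedding.refl (Fin b.card))
  tensorUnit := ⟨0⟩
  associator a b c := isoOfEquiv (finCongr (Nat.add_assoc a.card b.card c.card))
  leftUnitor a := isoOfEquiv (finCongr (Nat.zero_add a.card))
  rightUnitor a := isoOfEquiv (finCongr (Nat.add_zero a.card))

/-! How the associators act on the three blocks. -/

lemma castAdd_castAdd (a b c : ℕ) (i : Fin a) :
    Fin.cast (Nat.add_assoc a b c) (Fin.castAdd c (Fin.castAdd b i)) = Fin.castAdd (b + c) i := rfl
lemma castAdd_natAdd (a b c : ℕ) (i : Fin b) :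
    Fin.cast (Nat.add_assoc a b c) (Fin.castAdd c (Fin.natAdd a i)) =
      Fin.natAdd a (Fin.castAdd c i) := rfl
lemma cast_natAdd_add (a b c : ℕ) (i : Fin c) :
    Fin.cast (Nat.add_assoc a b c) (Fin.natAdd (a + b) i) = Fin.natAdd a (Fin.natAdd b i) :=
  Fin.ext (Nat.add_assoc a b i)

lemma castAdd_symm (a b c : ℕ) (i : Fin a) :
    Fin.cast (Nat.add_assoc a b c).symm (Fin.castAdd (b + c) i) =
      Fin.castAdd c (Fin.castAdd b i) := rfl
lemma natAdd_castAdd_symm (a b c : ℕ) (i : Fin b) :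
    Fin.cast (Nat.add_assoc a b c).symm (Fin.natAdd a (Fin.castAdd c i)) =
      Fin.castAdd c (Fin.natAdd a i) := rfl
lemma natAdd_natAdd_symm (a b c : ℕ) (i : Fin c) :
    Fin.cast (Nat.add_assoc a b c).symm (Fin.natAdd a (Fin.natAdd b i)) =
      Fin.natAdd (a + b) i := Fin.ext (Nat.add_assoc a b i).symm
lemma natAdd_zero_cast (n : ℕ) (j : Fin n) : Fin.cast (Nat.zero_add n) (Fin.natAdd 0 j) = j :=
  Fin.ext (Nat.zero_add _)

instance : MonoidalCategory InjCat := MonoidalCategory.ofTensorHom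
  (id_tensorHom_id := fun a b => Function.Embedding.ext fun i => by
    induction i using Fin.addCases
    · exact concat_castAdd _ _ _
    · exact concat_natAdd _ _ _)
  (tensorHom_comp_tensorHom := fun f₁ f₂ g₁ g₂ => Function.Embedding.ext fun i => by
    induction i using Fin.addCases
    · exact (congrArg (concat g₁ g₂) (concat_castAdd f₁ f₂ _)).trans
        ((concat_castAdd g₁ g₂ _).trans (concat_castAdd (f₁.trans g₁) (f₂.trans g₂) _).symm)
    · exact (congrArg (concat g₁ g₂) (concat_natAdd f₁ f₂ _)).trans
        ((concat_natAdd g₁ g₂ _).trans (concat_natAdd (f₁.trans g₁) (f₂.trans g₂) _).symm))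
  (associator_naturality := fun {X₁ X₂ X₃ Y₁ Y₂ Y₃} (f : Fin X₁.card ↪ Fin Y₁.card)
      (g : Fin X₂.card ↪ Fin Y₂.card) (h : Fin X₃.card ↪ Fin Y₃.card) =>
      Function.Embedding.ext fun (i : Fin (X₁.card + X₂.card + X₃.card)) => by
    change Fin.cast (Nat.add_assoc _ _ _) (concat (concat f g) h i) =
      concat f (concat g h) (Fin.cast (Nat.add_assoc _ _ _) i)
    induction i using Fin.addCases with
    | left i =>
      induction i using Fin.addCases with
      | left i =>
        rw [concat_castAdd, concat_castAdd, castAdd_castAdd, castAdd_castAdd, concat_castAdd]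
      | right i =>
        rw [concat_castAdd, concat_natAdd, castAdd_natAdd, castAdd_natAdd, concat_natAdd,
          concat_castAdd]
    | right i =>
      rw [concat_natAdd, cast_natAdd_add, cast_natAdd_add, concat_natAdd, concat_natAdd])
  (leftUnitor_naturality := fun {X Y} (f : Fin X.card ↪ Fin Y.card) =>
      Function.Embedding.ext fun (i : Fin (0 + X.card)) => by
    change Fin.cast (Nat.zero_add _) (concat (Function.Embedding.refl (Fin 0)) f i) =
      f (Fin.cast (Nat.zero_add _) i)
    induction i using Fin.addCases with
    | left i => exact i.elim0
    | right i => rw [concat_natAdd, natAdd_zero_cast, natAdd_zero_cast])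
  (rightUnitor_naturality := fun {X Y} (f : Fin X.card ↪ Fin Y.card) =>
      Function.Embedding.ext fun (i : Fin (X.card + 0)) => by
    change Fin.cast (Nat.add_zero _) (concat f (Function.Embedding.refl (Fin 0)) i) =
      f (Fin.cast (Nat.add_zero _) i)
    induction i using Fin.addCases with
    | left i => rw [concat_castAdd]; rfl
    | right i => exact i.elim0)
  (pentagon := fun W X Y Z => Function.Embedding.ext
      fun (i : Fin (W.card + X.card + Y.card + Z.card)) => by
    change concat (Function.Embedding.refl (Fin W.card))
        (finCongr (Nat.add_assoc X.card Y.card Z.card)).toEmbedding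
        (Fin.cast (Nat.add_assoc W.card (X.card + Y.card) Z.card)
          (concat (finCongr (Nat.add_assoc W.card X.card Y.card)).toEmbedding
            (Function.Embedding.refl (Fin Z.card)) i)) =
      Fin.cast (Nat.add_assoc W.card X.card (Y.card + Z.card))
        (Fin.cast (Nat.add_assoc (W.card + X.card) Y.card Z.card) i)
    generalize W.card = a at i ⊢
    generalize X.card = b at i ⊢
    generalize Y.card = c at i ⊢
    generalize Z.card = d at i ⊢
    induction i using Fin.addCases with
    | left i =>
      induction i using Fin.addCases with
      | left i =>
        induction i using Fin.addCases with
        | left i =>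
          rw [concat_castAdd]
          change concat _ _ (Fin.castAdd _ _) = _
          rw [concat_castAdd]
          rfl
        | right i =>
          rw [concat_castAdd]
          change concat _ _ (Fin.natAdd _ (Fin.castAdd _ (Fin.castAdd _ i))) = _
          rw [concat_natAdd]
          rfl
      | right i =>
        rw [concat_castAdd]
        change concat _ _ (Fin.cast (Nat.add_assoc a (b + c) d) (Fin.castAdd d
          (Fin.cast (Nat.add_assoc a b c) (Fin.natAdd (a + b) i)))) = _
        rw [cast_natAdd_add, castAdd_natAdd, concat_natAdd]
        exact Fin.ext (Nat.add_assoc _ _ _).symm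
    | right i =>
      rw [concat_natAdd, cast_natAdd_add]
      exact (congrArg Fin.val (concat_natAdd _ _ _)) |> fun h => Fin.ext (h.trans
        (by simp [finCongr, Nat.add_assoc])))
  (triangle := fun X Y => Function.Embedding.ext fun (i : Fin (X.card + 0 + Y.card)) => by
    change concat (Function.Embedding.refl (Fin X.card)) (finCongr (Nat.zero_add Y.card)).toEmbedding
        (Fin.cast (Nat.add_assoc X.card 0 Y.card) i) =
      concat (finCongr (Nat.add_zero X.card)).toEmbedding (Function.Embedding.refl (Fin Y.card)) i
    induction i using Fin.addCases with
    | left i =>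
      rw [concat_castAdd]
      exact concat_castAdd _ _ (show Fin X.card from i)
    | right i =>
      rw [concat_natAdd, cast_natAdd_add, concat_natAdd]
      exact congrArg (Fin.natAdd X.card) (natAdd_zero_cast _ _))

/-- The symmetry isomorphism is the shuffle that interchanges the two blocks. -/
instance : BraidedCategory InjCat where
  braiding a b := isoOfEquiv (finAddFlip (m := a.card) (n := b.card))
  braiding_naturality_right := fun X Y Z (f : Fin Y.card ↪ Fin Z.card) =>
      Function.Embedding.ext fun (i : Fin (X.card + Y.card)) => by
    change finAddFlip (concat (Function.Embedding.refl (Fin X.card)) f i) =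
      concat f (Function.Embedding.refl (Fin X.card)) (finAddFlip i)
    induction i using Fin.addCases with
    | left i => simp
    | right i => simp
  braiding_naturality_left := fun {X Y} (f : Fin X.card ↪ Fin Y.card) Z =>
      Function.Embedding.ext fun (i : Fin (X.card + Z.card)) => by
    change finAddFlip (concat f (Function.Embedding.refl (Fin Z.card)) i) =
      concat (Function.Embedding.refl (Fin Z.card)) f (finAddFlip i)
    induction i using Fin.addCases with
    | left i => simp
    | right i => simp
  hexagon_forward := fun X Y Z =>
      Function.Embedding.ext fun (i : Fin (X.card + Y.card + Z.card)) => by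
    change Fin.cast (Nat.add_assoc Y.card Z.card X.card)
        (finAddFlip (Fin.cast (Nat.add_assoc X.card Y.card Z.card) i)) =
      concat (Function.Embedding.refl (Fin Y.card)) finAddFlip.toEmbedding
        (Fin.cast (Nat.add_assoc Y.card X.card Z.card)
          (concat finAddFlip.toEmbedding (Function.Embedding.refl (Fin Z.card)) i))
    induction i using Fin.addCases with
    | left i =>
      induction i using Fin.addCases with
      | left i =>
        rw [castAdd_castAdd, concat_castAdd]
        simp [castAdd_natAdd, cast_natAdd_add]
      | right i =>
        rw [castAdd_natAdd, concat_castAdd]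
        simp [castAdd_castAdd]
    | right i =>
      rw [cast_natAdd_add, concat_natAdd]
      simp [castAdd_natAdd, cast_natAdd_add]
  hexagon_reverse := fun X Y Z =>
      Function.Embedding.ext fun (i : Fin (X.card + (Y.card + Z.card))) => by
    change Fin.cast (Nat.add_assoc Z.card X.card Y.card).symm
        (finAddFlip (Fin.cast (Nat.add_assoc X.card Y.card Z.card).symm i)) =
      concat finAddFlip.toEmbedding (Function.Embedding.refl (Fin Y.card))
        (Fin.cast (Nat.add_assoc X.card Z.card Y.card).symm
          (concat (Function.Embedding.refl (Fin X.card)) finAddFlip.toEmbedding i))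
    induction i using Fin.addCases with
    | left i =>
      rw [castAdd_symm, concat_castAdd]
      change _ = concat _ _ (Fin.cast _ (Fin.castAdd _ i))
      rw [castAdd_symm, concat_castAdd]
      simp [natAdd_castAdd_symm]
    | right i =>
      induction i using Fin.addCases with
      | left i =>
        rw [natAdd_castAdd_symm, concat_natAdd]
        simp [natAdd_natAdd_symm]
      | right i =>
        rw [natAdd_natAdd_symm, concat_natAdd]
        simp [natAdd_castAdd_symm, castAdd_symm]

instance : SymmetricCategory InjCat where
  symmetry a b := Function.Embedding.ext fun (i : Fin (a.card + b.card)) => by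
    change finAddFlip (finAddFlip i) = i
    induction i using Fin.addCases with
    | left i => simp
    | right i => simp

end InjCat

/-! ## The symmetric monoidal structure on functor categories given by Day convolution

Mathlib provides the monoidal structure on `DayFunctor C V` (the functors `C ⥤ V`, with tensor
product the left Kan extension of `(x, y) ↦ F x ⊗ G y` along `⊗ : C × C ⥤ C`). We add the symmetry. -/

namespace DaySymmetric

open scoped ExternalProduct
open MonoidalCategory.DayFunctor LawfulDayConvolutionMonoidalCategoryStruct

variable {C : Type u₁} [Category.{v₁} C] {V : Type u₂} [Category.{v₂} V]
    [MonoidalCategory C] [MonoidalCategory V]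
variable
    [hasDayConvolution : ∀ (F G : C ⥤ V),
      (tensor C).HasPointwiseLeftKanExtension (F ⊠ G)]
    [hasDayConvolutionUnit :
      (Functor.fromPUnit.{0} <| 𝟙_ C).HasPointwiseLeftKanExtension
        (Functor.fromPUnit.{0} <| 𝟙_ V)]
    [∀ (v : V) (d : C), Limits.PreservesColimitsOfShape
      (CostructuredArrow (tensor C) d) (tensorLeft v)]
    [∀ (v : V) (d : C), Limits.PreservesColimitsOfShape
      (CostructuredArrow (tensor C) d) (tensorRight v)]
    [∀ (v : V) (d : C), Limits.PreservesColimitsOfShape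
      (CostructuredArrow (Functor.fromPUnit.{0} <| 𝟙_ C) d) (tensorLeft v)]
    [∀ (v : V) (d : C), Limits.PreservesColimitsOfShape
      (CostructuredArrow (Functor.fromPUnit.{0} <| 𝟙_ C) d) (tensorRight v)]
    [∀ (v : V) (d : C × C),
      Limits.PreservesColimitsOfShape
        (CostructuredArrow ((𝟭 C).prod <| Functor.fromPUnit.{0} <| 𝟙_ C) d)
        (tensorRight v)]
    [∀ (v : V) (d : C × C),
      Limits.PreservesColimitsOfShape
        (CostructuredArrow ((tensor C).prod (𝟭 C)) d) (tensorRight v)]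

attribute [local instance] convolution convolution₂ convolution₂'


variable (F G : DayFunctor C V)

variable (C V) in
/-- The forgetful functor to the functor category. -/
noncomputable abbrev U : DayFunctor C V ⥤ C ⥤ V := ι C V (DayFunctor C V)

variable (C V) in
/-- The forgetful functor is fully faithful. -/
noncomputable def ffU : (U C V).FullyFaithful := (equiv C V).fullyFaithfulFunctor

lemma map_whiskerLeft {G G' : DayFunctor C V} (f : G ⟶ G') :
    (U C V).map (F ◁ f) = DayConvolution.map (𝟙 ((U C V).obj F)) ((U C V).map f) := by
  rw [← id_tensorHom, ι_map_tensorHom_hom_eq_tensorHom, CategoryTheory.Functor.map_id]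

lemma map_whiskerRight {G G' : DayFunctor C V} (f : G ⟶ G') :
    (U C V).map (f ▷ F) = DayConvolution.map ((U C V).map f) (𝟙 ((U C V).obj F)) := by
  rw [← tensorHom_id, ι_map_tensorHom_hom_eq_tensorHom, CategoryTheory.Functor.map_id]

lemma map_assoc (H : DayFunctor C V) : (U C V).map (α_ F G H).hom =
    (DayConvolution.associator ((U C V).obj F) ((U C V).obj G) ((U C V).obj H)).hom :=
  ι_map_associator_hom_eq_associator_hom C V (DayFunctor C V) F G H

lemma map_assoc_inv (H : DayFunctor C V) : (U C V).map (α_ F G H).inv =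
    (DayConvolution.associator ((U C V).obj F) ((U C V).obj G) ((U C V).obj H)).inv := by
  rw [← cancel_epi ((U C V).map (α_ F G H).hom), ← Functor.map_comp, Iso.hom_inv_id,
    map_assoc, Iso.hom_inv_id]
  exact CategoryTheory.Functor.map_id _ _

variable [SymmetricCategory C] [SymmetricCategory V]

/-- The symmetry isomorphism of the Day convolution. -/
noncomputable def braidingIso : F ⊗ G ≅ G ⊗ F :=
  (ffU C V).preimageIso (DayConvolution.braiding ((U C V).obj F) ((U C V).obj G))

lemma map_braidingIso : (U C V).map (braidingIso F G).hom =
    (DayConvolution.braiding ((U C V).obj F) ((U C V).obj G)).hom := by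
  exact (ffU C V).map_preimage _

noncomputable instance : BraidedCategory (DayFunctor C V) where
  braiding F G := braidingIso F G
  braiding_naturality_right F G H f := by
    apply (U C V).map_injective
    rw [Functor.map_comp, Functor.map_comp, map_braidingIso, map_braidingIso, map_whiskerLeft,
      map_whiskerRight]
    exact DayConvolution.braiding_naturality_right _ _
  braiding_naturality_left f H := by
    apply (U C V).map_injective
    rw [Functor.map_comp, Functor.map_comp, map_braidingIso, map_braidingIso, map_whiskerLeft,
      map_whiskerRight]
    exact DayConvolution.braiding_naturality_left _ _
  hexagon_forward F G H := by
    apply (U C V).map_injective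
    simp only [Functor.map_comp, map_braidingIso, map_whiskerLeft, map_whiskerRight, map_assoc]
    exact DayConvolution.hexagon_forward ((U C V).obj F) ((U C V).obj G) ((U C V).obj H)
  hexagon_reverse F G H := by
    apply (U C V).map_injective
    simp only [Functor.map_comp, map_braidingIso, map_whiskerLeft, map_whiskerRight, map_assoc_inv]
    exact DayConvolution.hexagon_reverse ((U C V).obj F) ((U C V).obj G) ((U C V).obj H)

noncomputable instance : SymmetricCategory (DayFunctor C V) where
  symmetry F G := by
    apply (U C V).map_injective
    rw [Functor.map_comp, CategoryTheory.Functor.map_id]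
    exact (congrArg₂ (· ≫ ·) (map_braidingIso F G) (map_braidingIso G F)).trans
      (DayConvolution.symmetry ((U C V).obj F) ((U C V).obj G))

/-- The symmetry `F ⊠ G ≅ G ⊠ F` is induced by the symmetry `F(x) × G(y) ≅ G(y) × F(x)` and the
shuffle `y ⊔ x ≅ x ⊔ y`. -/
lemma η_braiding (x y : C) :
    (η F G).app (x, y) ≫ (β_ F G).hom.natTrans.app (x ⊗ y) =
      (β_ (F.functor.obj x) (G.functor.obj y)).hom ≫ (η G F).app (y, x) ≫
        (G ⊗ F).functor.map (β_ y x).hom := by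
  have h := DayConvolution.unit_app_braiding_hom_app ((U C V).obj F) ((U C V).obj G) x y
  rw [← map_braidingIso] at h
  exact h

end DaySymmetric

/-! ## A homomorphism out of the symmetric groups from the Coxeter relations -/

namespace Tower
open Equiv
variable {G : ℕ → Type w} [∀ n, Group (G n)] (e : ∀ n, G n →* G (n + 1)) (t : ∀ n, G (n + 2))

/-- The `i`-th adjacent transposition, built from the first ones `t` and the shifts `e`. -/
def gen : (n : ℕ) → Fin n → G (n + 1)
  | n + 1, i => Fin.cases (t n) (fun j => e (n + 1) (gen n j)) i

/-- The cycle that moves `0` to `k` and keeps the order of the other elements. -/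
def cyc : (n : ℕ) → Fin (n + 1) → G (n + 1)
  | 0, _ => 1
  | n + 1, k => Fin.cases 1 (fun l => e (n + 1) (cyc n l) * t n) k

lemma cyc_zero (n : ℕ) : cyc e t n 0 = 1 := by cases n <;> rfl

/-- The subgroup generated by the adjacent transpositions. -/
def genSub : (n : ℕ) → Subgroup (G n)
  | 0 => ⊥
  | n + 1 => Subgroup.closure (Set.range (gen e t n))

lemma map_genSub (n : ℕ) {g : G n} (hg : g ∈ genSub e t n) : e n g ∈ genSub e t (n + 1) := by
  cases n with
  | zero =>
    have : g = 1 := hg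
    rw [this, map_one]
    exact one_mem _
  | succ n =>
    refine Subgroup.closure_induction (p := fun g _ => e (n + 1) g ∈ genSub e t (n + 2))
      ?_ ?_ ?_ ?_ hg
    · rintro _ ⟨i, rfl⟩
      exact Subgroup.subset_closure ⟨i.succ, rfl⟩
    · rw [map_one]; exact one_mem _
    · intro a b _ _ ha hb
      rw [map_mul]; exact mul_mem ha hb
    · intro a _ ha
      rw [map_inv]; exact inv_mem ha

lemma gen_mul_cyc (ht : ∀ n, t n * t n = 1)
    (hc : ∀ n (g : G n), t n * e _ (e _ g) = e _ (e _ g) * t n)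
    (hb : ∀ n, t (n + 1) * e _ (t n) * t (n + 1) = e _ (t n) * t (n + 1) * e _ (t n)) :
    ∀ (n : ℕ) (i : Fin n) (k : Fin (n + 1)), ∃ k' : Fin (n + 1), ∃ h ∈ genSub e t n,
      gen e t n i * cyc e t n k = cyc e t n k' * e n h := by
  intro n
  induction n with
  | zero => exact fun i => i.elim0
  | succ n ih =>
    intro i k
    cases i using Fin.cases with
    | zero =>
      cases k using Fin.cases with
      | zero =>
        refine ⟨Fin.succ 0, 1, one_mem _, ?_⟩
        change t n * 1 = (e (n + 1) (cyc e t n 0) * t n) * e (n + 1) 1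
        simp [cyc_zero]
      | succ l =>
        cases l using Fin.cases with
        | zero =>
          refine ⟨0, 1, one_mem _, ?_⟩
          change t n * (e (n + 1) (cyc e t n 0) * t n) = 1 * e (n + 1) 1
          simp [cyc_zero, ht]
        | succ l =>
          cases n with
          | zero => exact l.elim0
          | succ n =>
            refine ⟨l.succ.succ, t n, Subgroup.subset_closure ⟨0, rfl⟩, ?_⟩
            change t (n + 1) * (e (n + 2) (e (n + 1) (cyc e t n l) * t n) * t (n + 1)) =
              (e (n + 2) (e (n + 1) (cyc e t n l) * t n) * t (n + 1)) * e (n + 2) (t n)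
            rw [map_mul, ← mul_assoc, ← mul_assoc, hc, mul_assoc, mul_assoc, ← mul_assoc (t (n + 1)),
              hb]
            simp only [mul_assoc]
    | succ j =>
      cases k using Fin.cases with
      | zero =>
        refine ⟨0, gen e t n j, ?_, ?_⟩
        · cases n with
          | zero => exact j.elim0
          | succ n => exact Subgroup.subset_closure ⟨j, rfl⟩
        · change e (n + 1) (gen e t n j) * 1 = 1 * e (n + 1) (gen e t n j)
          simp
      | succ l =>
        obtain ⟨l', h, hh, H⟩ := ih j l
        refine ⟨l'.succ, e n h, map_genSub e t n hh, ?_⟩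
        change e (n + 1) (gen e t n j) * (e (n + 1) (cyc e t n l) * t n) =
          (e (n + 1) (cyc e t n l') * t n) * e (n + 1) (e n h)
        rw [← mul_assoc, ← map_mul, H, map_mul, mul_assoc, ← hc, mul_assoc]

lemma gen_mul_self (ht : ∀ n, t n * t n = 1) :
    ∀ (n : ℕ) (i : Fin n), gen e t n i * gen e t n i = 1 := by
  intro n
  induction n with
  | zero => exact fun i => i.elim0
  | succ n ih =>
    intro i
    cases i using Fin.cases with
    | zero => exact ht n
    | succ j =>
      change e (n + 1) (gen e t n j) * e (n + 1) (gen e t n j) = 1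
      rw [← map_mul, ih, map_one]

lemma exists_of_mem (ht : ∀ n, t n * t n = 1)
    (hc : ∀ n (g : G n), t n * e _ (e _ g) = e _ (e _ g) * t n)
    (hb : ∀ n, t (n + 1) * e _ (t n) * t (n + 1) = e _ (t n) * t (n + 1) * e _ (t n))
    (n : ℕ) {g : G (n + 1)} (hg : g ∈ genSub e t (n + 1)) :
    ∃ k, ∃ h ∈ genSub e t n, g = cyc e t n k * e n h := by
  have inv (i : Fin n) : (gen e t n i)⁻¹ = gen e t n i := by
    rw [inv_eq_iff_mul_eq_one]
    exact gen_mul_self e t ht n i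
  refine Subgroup.closure_induction_left
    (p := fun g _ => ∃ k, ∃ h ∈ genSub e t n, g = cyc e t n k * e n h) ?_ ?_ ?_ hg
  · exact ⟨0, 1, one_mem _, by simp [cyc_zero]⟩
  · rintro _ ⟨i, rfl⟩ y _ ⟨k, h, hh, rfl⟩
    obtain ⟨k', h', hh', H⟩ := gen_mul_cyc e t ht hc hb n i k
    exact ⟨k', h' * h, mul_mem hh' hh, by rw [← mul_assoc, H, map_mul, mul_assoc]⟩
  · rintro _ ⟨i, rfl⟩ y _ ⟨k, h, hh, rfl⟩
    obtain ⟨k', h', hh', H⟩ := gen_mul_cyc e t ht hc hb n i k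
    exact ⟨k', h' * h, mul_mem hh' hh, by rw [inv, ← mul_assoc, H, map_mul, mul_assoc]⟩

/-- A permutation of `Fin n`, as a permutation of `{1, …, n} ⊆ Fin (n + 1)` that fixes `0`. -/
def permShift (n : ℕ) : Perm (Fin n) →* Perm (Fin (n + 1)) where
  toFun σ := Perm.decomposeFin.symm (0, σ)
  map_one' := by
    ext i
    cases i using Fin.cases <;> simp
  map_mul' σ τ := by
    ext i
    cases i using Fin.cases <;> simp

lemma permShift_zero (n : ℕ) (σ : Perm (Fin n)) : permShift n σ 0 = 0 := by
  simp [permShift]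

lemma permShift_succ (n : ℕ) (σ : Perm (Fin n)) (i : Fin n) :
    permShift n σ i.succ = (σ i).succ := by
  simp [permShift]

lemma permShift_injective (n : ℕ) : Function.Injective (permShift n) := by
  intro σ τ h
  ext i
  have := congrArg (fun f : Perm (Fin (n + 1)) => f i.succ) h
  simpa [permShift_succ] using congrArg Fin.val this

lemma permShift_swap (n : ℕ) (i j : Fin n) :
    permShift n (swap i j) = swap i.succ j.succ := by
  ext k
  cases k using Fin.cases with
  | zero =>
    rw [permShift_zero, swap_apply_of_ne_of_ne (Fin.succ_ne_zero _).symm (Fin.succ_ne_zero _).symm]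
  | succ k =>
    rw [permShift_succ, swap_apply_def, swap_apply_def]
    simp only [Fin.succ_inj]
    split_ifs <;> rfl

theorem exists_hom (ht : ∀ n, t n * t n = 1)
    (hc : ∀ n (g : G n), t n * e _ (e _ g) = e _ (e _ g) * t n)
    (hb : ∀ n, t (n + 1) * e _ (t n) * t (n + 1) = e _ (t n) * t (n + 1) * e _ (t n)) (n : ℕ) :
    ∃ φ : Perm (Fin (n + 1)) →* G (n + 1), ∀ i : Fin n, φ (swap i.castSucc i.succ) = gen e t n i := by
  let e' (n : ℕ) : Perm (Fin n) × G n →* Perm (Fin (n + 1)) × G (n + 1) :=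
    (permShift n).prodMap (e n)
  let t' (n : ℕ) : Perm (Fin (n + 2)) × G (n + 2) := (swap 0 1, t n)
  have gen' : ∀ (n : ℕ) (i : Fin n), gen e' t' n i = (swap i.castSucc i.succ, gen e t n i) := by
    intro n
    induction n with
    | zero => exact fun i => i.elim0
    | succ n ih =>
      intro i
      cases i using Fin.cases with
      | zero => rfl
      | succ j =>
        change e' (n + 1) (gen e' t' n j) = _
        rw [ih]
        exact Prod.ext (permShift_swap _ _ _) rfl
  have cyc' : ∀ (n : ℕ) (k : Fin (n + 1)), (cyc e' t' n k).1 0 = k := by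
    intro n
    induction n with
    | zero => exact fun i => Subsingleton.elim (α := Fin 1) _ _
    | succ n ih =>
      intro k
      cases k using Fin.cases with
      | zero => rfl
      | succ l =>
        change permShift (n + 1) (cyc e' t' n l).1 (swap 0 1 0) = _
        rw [swap_apply_left]
        exact (permShift_succ _ _ 0).trans (congrArg Fin.succ (ih l))
  have ht' : ∀ n, t' n * t' n = 1 := fun n => Prod.ext (swap_mul_self _ _) (ht n)
  have hc' : ∀ n g, t' n * e' _ (e' _ g) = e' _ (e' _ g) * t' n := by
    intro n g
    refine Prod.ext ?_ (hc n g.2)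
    change swap 0 1 * permShift _ (permShift _ g.1) = permShift _ (permShift _ g.1) * swap 0 1
    refine Equiv.ext fun i => ?_
    rw [Perm.mul_apply, Perm.mul_apply]
    cases i using Fin.cases with
    | zero =>
      rw [permShift_zero, swap_apply_left]
      exact ((permShift_succ _ _ 0).trans (congrArg Fin.succ (permShift_zero _ _))).symm
    | succ i =>
      rw [permShift_succ]
      cases i using Fin.cases with
      | zero =>
        rw [permShift_zero]
        change swap 0 1 1 = permShift _ _ (swap 0 1 1)
        rw [swap_apply_right, permShift_zero]
      | succ i =>
        have h (j : Fin n) : swap (0 : Fin (n + 2)) 1 j.succ.succ = j.succ.succ :=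
          swap_apply_of_ne_of_ne (Fin.succ_ne_zero _)
            (fun H => Fin.succ_ne_zero _ (Fin.succ_injective _ H))
        rw [permShift_succ, h, h, permShift_succ, permShift_succ]
  have hb' : ∀ n, t' (n + 1) * e' _ (t' n) * t' (n + 1) = e' _ (t' n) * t' (n + 1) * e' _ (t' n) := by
    intro n
    refine Prod.ext ?_ (hb n)
    change swap 0 1 * permShift _ (swap 0 1) * swap 0 1 =
      permShift _ (swap 0 1) * swap 0 1 * permShift _ (swap 0 1)
    rw [permShift_swap]
    have h01 : (0 : Fin (n + 3)) ≠ 1 := (Fin.succ_ne_zero (0 : Fin (n + 2))).symm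
    have h02 : (0 : Fin (n + 3)) ≠ Fin.succ 1 := (Fin.succ_ne_zero _).symm
    have h12 : (1 : Fin (n + 3)) ≠ Fin.succ 1 := fun h =>
      Fin.succ_ne_zero (0 : Fin (n + 1))
        (Fin.succ_injective _ (show Fin.succ (0 : Fin (n + 2)) = Fin.succ 1 from h)).symm
    change swap 0 1 * swap 1 (Fin.succ 1) * swap 0 1 =
      swap 1 (Fin.succ 1) * swap 0 1 * swap 1 (Fin.succ 1)
    rw [swap_mul_swap_mul_swap h01 h02, swap_comm 0 1, swap_comm 1 (Fin.succ 1),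
      swap_mul_swap_mul_swap h12.symm h02.symm, swap_comm]
  have inj : ∀ (n : ℕ) (g), g ∈ genSub e' t' n → g.1 = 1 → g = 1 := by
    intro n
    induction n with
    | zero => exact fun g hg _ => hg
    | succ n ih =>
      intro g hg h1
      obtain ⟨k, h, hh, rfl⟩ := exists_of_mem e' t' ht' hc' hb' n hg
      have hk : k = 0 := by
        have := congrArg (fun f : Perm (Fin (n + 1)) => f 0) h1
        change (cyc e' t' n k).1 (permShift n h.1 0) = 0 at this
        rwa [permShift_zero, cyc'] at this
      subst hk
      rw [cyc_zero, one_mul] at h1 ⊢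
      have : h = 1 := ih h hh (permShift_injective n (h1.trans (map_one _).symm))
      rw [this, map_one]
  let p : genSub e' t' (n + 1) →* Perm (Fin (n + 1)) :=
    (MonoidHom.fst _ _).comp (genSub e' t' (n + 1)).subtype
  have hp : Function.Bijective p := by
    constructor
    · rw [injective_iff_map_eq_one]
      exact fun g hg => Subtype.ext (inj _ g.1 g.2 hg)
    · rw [← MonoidHom.mrange_eq_top, ← top_le_iff, ← Perm.mclosure_swap_castSucc_succ,
        Submonoid.closure_le]
      rintro _ ⟨i, rfl⟩
      exact ⟨⟨gen e' t' n i, Subgroup.subset_closure ⟨i, rfl⟩⟩, congrArg Prod.fst (gen' n i)⟩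
  refine ⟨((MonoidHom.snd _ _).comp (genSub e' t' (n + 1)).subtype).comp
    (MulEquiv.ofBijective p hp).symm.toMonoidHom, fun i => ?_⟩
  have : (MulEquiv.ofBijective p hp).symm (swap i.castSucc i.succ) =
      ⟨gen e' t' n i, Subgroup.subset_closure ⟨i, rfl⟩⟩ := by
    rw [MulEquiv.symm_apply_eq]
    exact (congrArg Prod.fst (gen' n i)).symm
  change ((MulEquiv.ofBijective p hp).symm (swap i.castSucc i.succ)).1.2 = _
  rw [this]
  exact congrArg Prod.snd (gen' n i)
end Tower

/-! ## The action of the symmetric group on a tensor power -/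

namespace SymPow
variable {C : Type w} [Category.{v} C] [MonoidalCategory C]

/-- The tensor power `X ⊗ (X ⊗ (⋯ ⊗ (X ⊗ 𝟙)))` with `n` factors `X`. -/
def tpow (X : C) : ℕ → C
  | 0 => 𝟙_ C
  | n + 1 => X ⊗ tpow X n

variable [SymmetricCategory C]

/-- The symmetry isomorphism that interchanges the first two factors of `X ⊗ (X ⊗ T)`. -/
def swapFront (X T : C) : X ⊗ (X ⊗ T) ≅ X ⊗ (X ⊗ T) :=
  (α_ X X T).symm ≪≫ whiskerRightIso (β_ X X) T ≪≫ α_ X X T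

/-- The symmetry isomorphism of the tensor power that interchanges the factors in the adjacent
positions `i` and `i + 1`. -/
def adj (X : C) : (n : ℕ) → Fin n → (tpow X (n + 1) ≅ tpow X (n + 1))
  | n + 1, i => Fin.cases (swapFront X (tpow X n)) (fun j => whiskerLeftIso X (adj X n j)) i

lemma swapFront_sq (X T : C) : (swapFront X T).hom ≫ (swapFront X T).hom = 𝟙 _ := by
  simp [swapFront, ← comp_whiskerRight_assoc]

lemma swapFront_nat (X : C) {T T' : C} (f : T ⟶ T') :
    (swapFront X T).hom ≫ X ◁ X ◁ f = X ◁ X ◁ f ≫ (swapFront X T').hom := by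
  rw [tensor_whiskerLeft_symm]
  simp only [swapFront, Iso.trans_hom, Iso.symm_hom, whiskerRightIso_hom, Category.assoc,
    Iso.hom_inv_id_assoc, whisker_exchange_assoc]

lemma swapFront_braid (X T : C) :
    (swapFront X (X ⊗ T)).hom ≫ X ◁ (swapFront X T).hom ≫ (swapFront X (X ⊗ T)).hom =
    X ◁ (swapFront X T).hom ≫ (swapFront X (X ⊗ T)).hom ≫ X ◁ (swapFront X T).hom := by
  calc
    _ = 𝟙 _ ⊗≫ ((β_ X X).hom ▷ X ⊗≫ X ◁ (β_ X X).hom ⊗≫ (β_ X X).hom ▷ X) ▷ T ⊗≫ 𝟙 _ := by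
      simp only [swapFront, Iso.trans_hom, Iso.symm_hom, whiskerRightIso_hom]
      monoidal
    _ = 𝟙 _ ⊗≫ (𝟙 _ ⊗≫ (X ◁ (β_ X X).hom ⊗≫ (β_ X X).hom ▷ X ⊗≫ X ◁ (β_ X X).hom)
          ⊗≫ 𝟙 _) ▷ T ⊗≫ 𝟙 _ := by
      rw [BraidedCategory.yang_baxter']
    _ = _ := by
      simp only [swapFront, Iso.trans_hom, Iso.symm_hom, whiskerRightIso_hom]
      monoidal

/-- `X ⊗ -` on automorphisms. -/
def autWhisker (X T : C) : Aut T →* Aut (X ⊗ T) where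
  toFun f := whiskerLeftIso X f
  map_one' := by ext; exact MonoidalCategory.whiskerLeft_id _ _
  map_mul' f g := by ext; exact MonoidalCategory.whiskerLeft_comp _ _ _

lemma exists_permHom (X : C) (n : ℕ) :
    ∃ φ : Equiv.Perm (Fin (n + 1)) →* Aut (tpow X (n + 1)), ∀ i : Fin n,
      φ (Equiv.swap i.castSucc i.succ) = adj X n i := by
  obtain ⟨φ, hφ⟩ := Tower.exists_hom (G := fun n => Aut (tpow X n))
    (fun n => autWhisker X (tpow X n)) (fun n => swapFront X (tpow X n))
    (fun n => Iso.ext (swapFront_sq _ _))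
    (fun n g => Iso.ext (swapFront_nat X g.hom).symm)
    (fun n => Iso.ext (swapFront_braid X (tpow X n))) n
  refine ⟨φ, fun i => (hφ i).trans ?_⟩
  clear hφ φ
  induction n with
  | zero => exact i.elim0
  | succ n ih =>
    cases i using Fin.cases with
    | zero => rfl
    | succ j => exact congrArg (autWhisker X (tpow X (n + 1))) (ih j)

/-- The action of the symmetric group on the tensor power by permuting the factors: the unique
homomorphism that sends the transposition of `i` and `i + 1` to the symmetry isomorphism of the
factors in these positions. (In `Aut`, the product `f * g` is `g` followed by `f`.) -/
noncomputable def permHom (X : C) : (n : ℕ) → Equiv.Perm (Fin n) →* Aut (tpow X n)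
  | 0 => 1
  | n + 1 => (exists_permHom X n).choose

lemma permHom_swap (X : C) (n : ℕ) (i : Fin n) :
    permHom X (n + 1) (Equiv.swap i.castSucc i.succ) = adj X n i :=
  (exists_permHom X n).choose_spec i

lemma permHom_unique (X : C) (n : ℕ) (φ : Equiv.Perm (Fin (n + 1)) →* Aut (tpow X (n + 1)))
    (h : ∀ i : Fin n, φ (Equiv.swap i.castSucc i.succ) = adj X n i) : φ = permHom X (n + 1) := by
  refine MonoidHom.eq_of_eqOn_denseM (Equiv.Perm.mclosure_swap_castSucc_succ n) ?_
  rintro _ ⟨i, rfl⟩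
  rw [h, permHom_swap]

end SymPow

/-! ## The Joyal model structure on simplicial sets -/

namespace Joyal

/-- The inclusion of `A × {x}` into `A × E`, for a vertex `x` of `E`. -/
noncomputable def endpoint (A : SSet.{u}) {E : SSet.{u}} (x : E.obj (.op (.mk 0))) : A ⟶ A ⊗ E :=
  CartesianMonoidalCategory.lift (𝟙 A) (SSet.const x)

/-- `f` and `g` are related by an elementary homotopy, parametrized by the nerve of the
groupoid with two objects and exactly one morphism between any two objects. -/
def Homotopic {A Q : SSet.{u}} (f g : A ⟶ Q) : Prop :=
  ∃ H : A ⊗ SSet.coherentIso.{u} ⟶ Q,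
    endpoint A SSet.coherentIso.x₀ ≫ H = f ∧ endpoint A SSet.coherentIso.x₁ ≫ H = g

lemma endpoint_naturality {A B : SSet.{u}} (f : A ⟶ B) {E : SSet.{u}}
    (x : E.obj (.op (.mk 0))) : f ≫ endpoint B x = endpoint A x ≫ f ▷ E := by
  apply CartesianMonoidalCategory.hom_ext <;> simp [endpoint]

lemma Homotopic.precomp {A B Q : SSet.{u}} (f : A ⟶ B) {g h : B ⟶ Q} (H : Homotopic g h) :
    Homotopic (f ≫ g) (f ≫ h) := by
  obtain ⟨H, rfl, rfl⟩ := H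
  exact ⟨f ▷ _ ≫ H, by rw [← Category.assoc, ← endpoint_naturality, Category.assoc],
    by rw [← Category.assoc, ← endpoint_naturality, Category.assoc]⟩

/-- Homotopy classes of maps: the quotient by the equivalence relation generated by
elementary homotopies. -/
def HoClasses (A Q : SSet.{u}) : Type u := Quot (Homotopic (A := A) (Q := Q))

/-- Precomposition on homotopy classes. -/
def HoClasses.precomp {A B : SSet.{u}} (f : A ⟶ B) (Q : SSet.{u}) :
    HoClasses B Q → HoClasses A Q :=
  Quot.map (fun g => f ≫ g) (fun _ _ H => H.precomp f)

/-- Joyal equivalences: the maps that induce bijections on homotopy classes of maps into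
every quasi-category. -/
def equivalences : MorphismProperty SSet.{u} := fun _ _ f =>
  ∀ (Q : SSet.{u}) [SSet.Quasicategory Q], Function.Bijective (HoClasses.precomp f Q)

/-- Fibrations of the Joyal model structure: the right lifting property with respect to the
monomorphisms that are Joyal equivalences. -/
def fibrations : MorphismProperty SSet.{u} :=
  (MorphismProperty.monomorphisms SSet.{u} ⊓ equivalences).rlp

end Joyal

/-! ## The positive model structures on `I`-diagrams of simplicial sets -/

namespace IDiagram

/-- Positive level equivalences. -/
def posLevelEquivalences : MorphismProperty (InjCat ⥤ SSet.{u}) := fun _ _ f =>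
  ∀ n : InjCat, 1 ≤ n.card → Joyal.equivalences (f.app n)

/-- Positive level fibrations. -/
def posLevelFibrations : MorphismProperty (InjCat ⥤ SSet.{u}) := fun _ _ f =>
  ∀ n : InjCat, 1 ≤ n.card → Joyal.fibrations (f.app n)

/-- Positive level cofibrations. -/
def posLevelCofibrations : MorphismProperty (InjCat ⥤ SSet.{u}) :=
  (posLevelFibrations ⊓ posLevelEquivalences).llp

/-- The cofibrations of the positive `I`-model structure are by definition the positive level
cofibrations. -/
def posICofibrations : MorphismProperty (InjCat ⥤ SSet.{u}) := posLevelCofibrations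

/-- `X` is positive `I`-cofibrant. -/
def IsPosICofibrant (X : InjCat ⥤ SSet.{u}) : Prop := posICofibrations (initial.to X)

section

open scoped ExternalProduct

/-! Colimits in simplicial sets exist and are preserved by products, so that Mathlib's Day
convolution is defined on `I`-diagrams of simplicial sets. -/

instance (F G : InjCat ⥤ SSet.{u}) :
    (tensor InjCat).HasPointwiseLeftKanExtension (F ⊠ G) := inferInstance

instance (K : SSet.{u}) (d : InjCat) : PreservesColimitsOfShape
    (CostructuredArrow (tensor InjCat) d) (tensorLeft K) := inferInstance

instance (K : SSet.{u}) (d : InjCat) : PreservesColimitsOfShape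
    (CostructuredArrow (tensor InjCat) d) (tensorRight K) := inferInstance

end

/-- The `n`-fold power of `X` for the Day convolution product `⊠`, as an object of the
symmetric monoidal category of `I`-diagrams. -/
noncomputable def dayPow (X : InjCat ⥤ SSet.{u}) (n : ℕ) : DayFunctor InjCat SSet.{u} :=
  SymPow.tpow (DayFunctor.mk X) n

/-- The `n`-fold power `X^{⊠ n}`, as a functor. -/
noncomputable def boxPow (X : InjCat ⥤ SSet.{u}) (n : ℕ) : InjCat ⥤ SSet.{u} :=
  (dayPow X n).functor

/-- The action of the symmetric group on the simplicial set `X^{⊠ n}(m)`. -/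
noncomputable def boxPowAction (X : InjCat ⥤ SSet.{u}) (n : ℕ) (m : InjCat) :
    Equiv.Perm (Fin n) →* Aut ((boxPow X n).obj m) :=
  (((DayFunctor.equiv InjCat SSet.{u}).functor ⋙ (evaluation InjCat SSet.{u}).obj m).mapAut
    (dayPow X n)).comp (SymPow.permHom (DayFunctor.mk X) n)

/-- An action of a group on a simplicial set is free if it is free on the set of `k`-simplices
for all `k`: only the neutral element fixes a simplex. -/
def IsFreeAction {G : Type*} [Group G] {K : SSet.{u}} (ρ : G →* Aut K) : Prop :=
  ∀ (k : SimplexCategoryᵒᵖ) (x : K.obj k) (g : G), (ρ g).hom.app k x = x → g = 1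

end IDiagram

/-! Freeness is pulled back along an equivariant map: a permutation that fixes a simplex also fixes
its image, so it suffices to map `X^{⊠ n}` equivariantly to a diagram on which the symmetric group
acts freely.

The codiscrete simplicial set on a nonempty set is a trivially fibrant object of the Joyal
structure. Maps into it are arbitrary functions on vertices, so they extend along monomorphisms, and
any two of them are homotopic. Hence a positive cofibrant `X` maps to the diagram `m ↦ codisc {1, …,
m}` (`Codisc.nonempty_hom`). This diagram is empty at `m = 0`, which is harmless because only
positive levels are tested. Thus each vertex of `X(m)` acquires a point of `m`, naturally in `m`.

A simplex of `X^{⊠ n}(m)` is represented by simplices of `X(m₁), …, X(mₙ)` and an injection `m₁ ⊔ ⋯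
⊔ mₙ → m`. The points chosen in the different blocks are distinct, so each vertex gives an injective
word of length `n` in `m`. This is the map `InjPow.powHom` to the codiscrete diagram on `I(n, m)`.
Permuting the factors permutes the letters (`InjPow.permHom_powHom`), which need only be checked on
adjacent transpositions. A word without repeated letters is fixed by the identity permutation only.
-/

/-! ### Codiscrete simplicial sets and the Joyal model structure -/

namespace Codisc

/-- The codiscrete simplicial set on a set of vertices: a `k`-simplex is any sequence of `k + 1`
vertices. -/
def codisc : Type u ⥤ SSet.{u} where
  obj S :=
    { obj k := Fin (k.unop.len + 1) → S
      map f := ↾fun p i => p (f.unop.toOrderHom i) }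
  map g := { app k := ↾fun p i => g (p i) }

/-- A simplex of a codiscrete simplicial set, as a sequence of vertices. -/
def coord {S : Type u} {k : SimplexCategoryᵒᵖ} (p : (codisc.obj S).obj k) :
    Fin (k.unop.len + 1) → S := p

/-- The `i`-th vertex of a simplex. -/
def vertex (A : SSet.{u}) {k : SimplexCategoryᵒᵖ} (a : A.obj k) (i : Fin (k.unop.len + 1)) :
    A.obj (.op (.mk 0)) :=
  A.map (SimplexCategory.const (.mk 0) k.unop i).op a

lemma vertex_zero (A : SSet.{u}) (a : A.obj (.op (.mk 0))) : vertex A a 0 = a := by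
  have : SimplexCategory.const (.mk 0) (.mk 0) 0 = 𝟙 _ := by
    ext i
    exact congrArg Fin.val (Subsingleton.elim (α := Fin 1) _ _)
  exact (congrArg (fun t => A.map (Quiver.Hom.op t) a) this).trans (by simp)

lemma vertex_map (A : SSet.{u}) {k l : SimplexCategoryᵒᵖ} (f : k ⟶ l) (a : A.obj k)
    (i : Fin (l.unop.len + 1)) :
    vertex A (A.map f a) i = vertex A a (f.unop.toOrderHom i) := by
  simp only [vertex]
  rw [← CategoryTheory.comp_apply, ← Functor.map_comp]
  rfl

lemma vertex_app {A B : SSet.{u}} (f : A ⟶ B) {k : SimplexCategoryᵒᵖ} (a : A.obj k)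
    (i : Fin (k.unop.len + 1)) : f.app _ (vertex A a i) = vertex B (f.app k a) i := by
  simp only [vertex]
  exact NatTrans.naturality_apply f _ _

/-- The map into a codiscrete simplicial set with given values on vertices. -/
def lift {A : SSet.{u}} {S : Type u} (f : A.obj (.op (.mk 0)) → S) : A ⟶ codisc.obj S where
  app k := ↾fun a i => f (vertex A a i)
  naturality k l g := by
    ext a
    funext i
    exact congrArg f (vertex_map A g a i)

lemma app_eq {A : SSet.{u}} {S : Type u} (g : A ⟶ codisc.obj S) {k : SimplexCategoryᵒᵖ}
    (a : A.obj k) (i : Fin (k.unop.len + 1)) :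
    coord (g.app k a) i =
      coord (g.app (.op (.mk 0)) (vertex A a i)) 0 := by
  rw [vertex_app]
  rfl

/-- Simplices of the target are sequences of vertices, and maps commute with taking vertices.
Together with `lift` this makes `codisc` right adjoint to the set of vertices. -/
lemma hom_ext {A : SSet.{u}} {S : Type u} {g h : A ⟶ codisc.obj S}
    (H : ∀ a : A.obj (.op (.mk 0)), coord (g.app _ a) 0 =
      coord (h.app _ a) 0) : g = h := by
  ext k a
  funext i
  exact (app_eq g a i).trans ((H _).trans (app_eq h a i).symm)

lemma lift_app_zero {A : SSet.{u}} {S : Type u} (f : A.obj (.op (.mk 0)) → S)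
    (a : A.obj (.op (.mk 0))) :
    coord ((lift f).app _ a) 0 = f a := by
  exact congrArg f (vertex_zero A a)

lemma comp_lift_app_zero {A B : SSet.{u}} {S : Type u} (i : A ⟶ B)
    (f : B.obj (.op (.mk 0)) → S) (a : A.obj (.op (.mk 0))) :
    coord ((i ≫ lift f).app _ a) 0 = f (i.app _ a) :=
  lift_app_zero f (i.app _ a)

/-- Lifting against a monomorphism amounts to extending a function on vertices along an injection.
-/
lemma fibrations_of_isTerminal {S : Type u} [Nonempty S] {T : SSet.{u}} (hT : IsTerminal T)
    (p : codisc.obj S ⟶ T) : Joyal.fibrations p := by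
  rintro A B i ⟨hi, -⟩
  have : Mono i := hi
  refine ⟨fun {f g} sq => ?_⟩
  have hinj : Function.Injective (i.app (.op (.mk 0))) :=
    (CategoryTheory.mono_iff_injective _).1 inferInstance
  -- Vertices outside the image of `i` are sent to an arbitrary element of `S`; this is where `S`
  -- must be nonempty.
  refine ⟨⟨⟨lift (Function.extend (i.app _)
    (fun a => coord (f.app _ a) 0) (fun _ => Classical.arbitrary S)), ?_,
    hT.hom_ext _ _⟩⟩⟩
  refine hom_ext fun a => ?_
  refine (comp_lift_app_zero _ _ a).trans ?_
  exact hinj.extend_apply _ _ _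

/-- A homotopy is any function on vertices with the prescribed values at the two ends. The function
`F` takes the values of `f` over `x₀` and those of `g` over the remaining vertices. -/
lemma homotopic {S : Type u} {A : SSet.{u}} (f g : A ⟶ codisc.obj S) : Joyal.Homotopic f g := by
  classical
  let F (a : (A ⊗ SSet.coherentIso.{u}).obj (.op (.mk 0))) : S :=
    if (SemiCartesianMonoidalCategory.snd A SSet.coherentIso.{u}).app _ a = SSet.coherentIso.x₀ then
      coord (f.app _ ((SemiCartesianMonoidalCategory.fst A SSet.coherentIso.{u}).app _ a)) 0
    else coord (g.app _ ((SemiCartesianMonoidalCategory.fst A SSet.coherentIso.{u}).app _ a)) 0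
  have hc (x : SSet.coherentIso.{u}.obj (.op (.mk 0))) (a : A.obj (.op (.mk 0))) :
      (SSet.const x : A ⟶ _).app _ a = x :=
    vertex_zero _ x
  -- The two ends must be distinct for the case distinction in `F` to give `g` over `x₁`.
  have hne : (SSet.coherentIso.x₁.{u} : SSet.coherentIso.{u}.obj (.op (.mk 0))) ≠
      SSet.coherentIso.x₀ := by
    intro h
    have := congrArg (fun t : ComposableArrows WalkingIso.{u} 0 => t.obj 0) h
    cases this
  refine ⟨lift F, hom_ext fun a => ?_, hom_ext fun a => ?_⟩
  · refine (comp_lift_app_zero _ F a).trans ?_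
    exact if_pos (hc SSet.coherentIso.x₀ a)
  · refine (comp_lift_app_zero _ F a).trans ?_
    exact if_neg (fun h => hne ((hc SSet.coherentIso.x₁ a).symm.trans h))

lemma homotopic_postcomp {A B Q : SSet.{u}} {f g : A ⟶ B} (H : Joyal.Homotopic f g) (h : B ⟶ Q) :
    Joyal.Homotopic (f ≫ h) (g ≫ h) := by
  obtain ⟨H, rfl, rfl⟩ := H
  exact ⟨H ≫ h, by simp, by simp⟩

/-- A point of `S` gives a section `s` of `p`, and `p ≫ s` is homotopic to the identity because any
two maps into `codisc.obj S` are. Precomposition with `s` is therefore inverse to precomposition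
with `p` on homotopy classes. -/
lemma equivalences_of_isTerminal {S : Type u} [Nonempty S] {T : SSet.{u}} (hT : IsTerminal T)
    (p : codisc.obj S ⟶ T) : Joyal.equivalences p := by
  intro Q _
  let s : T ⟶ codisc.obj S := lift (fun _ => Classical.arbitrary S)
  have hs : s ≫ p = 𝟙 T := hT.hom_ext _ _
  refine Function.bijective_iff_has_inverse.2 ⟨Joyal.HoClasses.precomp s Q, ?_, ?_⟩
  · rintro ⟨g⟩
    exact congrArg (Quot.mk _) ((Category.assoc _ _ _).symm.trans (by rw [hs, Category.id_comp]))
  · rintro ⟨g⟩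
    refine Quot.sound ?_
    have := homotopic_postcomp (homotopic (p ≫ s) (𝟙 _)) g
    rwa [Category.assoc, Category.id_comp] at this

/-- Positive cofibrant diagrams map to every codiscrete diagram that is nonempty in positive
levels. -/
lemma nonempty_hom {X : InjCat ⥤ SSet.{u}} (hX : IDiagram.IsPosICofibrant X)
    (S : InjCat ⥤ Type u) (hS : ∀ n : InjCat, 1 ≤ n.card → Nonempty (S.obj n)) :
    Nonempty (X ⟶ S ⋙ codisc) := by
  have hT (n : InjCat) : IsTerminal ((⊤_ (InjCat ⥤ SSet.{u})).obj n) :=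
    terminalIsTerminal.isTerminalObj ((evaluation _ _).obj n) _
  -- The map to the terminal diagram is a fibration and an equivalence in each positive level,
  -- whatever `S` is at level `0`, so `X` lifts against it.
  have := hX (terminal.from (S ⋙ codisc)) ⟨fun n hn => by
      have := hS n hn
      exact fibrations_of_isTerminal (hT n) _, fun n hn => by
      have := hS n hn
      exact equivalences_of_isTerminal (hT n) _⟩
  have sq : CommSq (initial.to (S ⋙ codisc)) (initial.to X) (terminal.from (S ⋙ codisc))
    (terminal.from X) := ⟨terminal.hom_ext _ _⟩
  exact ⟨sq.lift⟩

end Codisc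

/-! ### Simplices of Day convolution products -/

namespace DayElements

open MonoidalCategory.DayFunctor LawfulDayConvolutionMonoidalCategoryStruct
open scoped ExternalProduct

variable {F G H : DayFunctor InjCat SSet.{u}} {k : SimplexCategoryᵒᵖ}

/-- A simplex of a product. -/
def pair {A B : SSet.{u}} {k : SimplexCategoryᵒᵖ} (a : A.obj k) (b : B.obj k) :
    (A ⊗ B).obj k := (a, b)

lemma app_congr {A B : SSet.{u}} {f g : A ⟶ B} (h : f = g) {k : SimplexCategoryᵒᵖ}
    (a : A.obj k) : f.app k a = g.app k a := by rw [h]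

/-- The product simplex of the Day convolution given by simplices of the two factors. -/
noncomputable def pure (F G : DayFunctor InjCat SSet.{u}) {k : SimplexCategoryᵒᵖ} {x y : InjCat}
    (a : (F.functor.obj x).obj k) (b : (G.functor.obj y).obj k) :
    ((F ⊗ G).functor.obj (x ⊗ y)).obj k :=
  ((η F G).app (x, y)).app k (pair a b)

/-- The map on `k`-simplices induced by an injection. -/
def push (F : DayFunctor InjCat SSet.{u}) {k : SimplexCategoryᵒᵖ} {x y : InjCat} (f : x ⟶ y)
    (a : (F.functor.obj x).obj k) : (F.functor.obj y).obj k :=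
  (F.functor.map f).app k a

/-- The action of a map of diagrams on simplices. -/
def act (f : F ⟶ G) {x : InjCat} (a : (F.functor.obj x).obj k) : (G.functor.obj x).obj k :=
  (f.natTrans.app x).app k a

lemma act_comp (f : F ⟶ G) (g : G ⟶ H) {x : InjCat} (a : (F.functor.obj x).obj k) :
    act (f ≫ g) a = act g (act f a) := rfl

lemma act_push (f : F ⟶ G) {x y : InjCat} (i : x ⟶ y) (a : (F.functor.obj x).obj k) :
    act f (push F i a) = push G i (act f a) :=
  ConcreteCategory.congr_hom (NatTrans.congr_app (f.natTrans.naturality i) k) a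

lemma push_id {x : InjCat} (a : (F.functor.obj x).obj k) :
    push F (𝟙 x) a = a := by
  simp [push]

lemma hom_ext {f g : F ⟶ G}
    (h : ∀ (x : InjCat) (k : SimplexCategoryᵒᵖ) (a : (F.functor.obj x).obj k), act f a = act g a) :
    f = g := by
  apply DayFunctor.hom_ext
  ext x k a
  exact h x k a

/-- The pointwise Kan extension is a colimit over the injections `x ⊔ y → m`. It remains one on
`k`-simplices, and every element of a colimit of sets comes from some stage. -/
lemma exists_pure {m : InjCat} (c : ((F ⊗ G).functor.obj m).obj k) :
    ∃ (x y : InjCat) (i : x ⊗ y ⟶ m) (a : (F.functor.obj x).obj k) (b : (G.functor.obj y).obj k),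
      c = push (F ⊗ G) i (pure F G a b) := by
  have h := isPointwiseLeftKanExtensionConvolutionExtensionUnit (C := InjCat) (V := SSet.{u}) F G m
  obtain ⟨j, ab, hab⟩ := Types.jointly_surjective_of_isColimit
    (isColimitOfPreserves ((evaluation _ _).obj k) h) c
  exact ⟨j.left.1, j.left.2, j.hom, ab.1, ab.2, hab.symm⟩

/-- By naturality, a map is determined on pushforwards of product simplices by its values on the
product simplices themselves. -/
lemma hom_ext_pure {f g : F ⊗ G ⟶ H}
    (h : ∀ (x y : InjCat) (k : SimplexCategoryᵒᵖ) (a : (F.functor.obj x).obj k)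
      (b : (G.functor.obj y).obj k), act f (pure F G a b) = act g (pure F G a b)) : f = g := by
  refine hom_ext fun m k c => ?_
  obtain ⟨x, y, i, a, b, rfl⟩ := exists_pure c
  rw [act_push, act_push, h]

lemma pure_push {x x' y y' : InjCat} (i : x ⟶ x') (j : y ⟶ y') (a : (F.functor.obj x).obj k)
    (b : (G.functor.obj y).obj k) :
    pure F G (push F i a) (push G j b) = push (F ⊗ G) (i ⊗ₘ j) (pure F G a b) :=
  app_congr (A := F.functor.obj x ⊗ G.functor.obj y)
    ((η F G).naturality (X := (x, y)) (Y := (x', y')) (i, j)) (pair a b)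

lemma pure_push_left {x x' y : InjCat} (i : x ⟶ x') (a : (F.functor.obj x).obj k)
    (b : (G.functor.obj y).obj k) :
    pure F G (push F i a) b = push (F ⊗ G) (i ▷ y) (pure F G a b) := by
  rw [← tensorHom_id, ← pure_push, push_id]

lemma act_whiskerLeft (f : G ⟶ H) {x y : InjCat} (a : (F.functor.obj x).obj k)
    (b : (G.functor.obj y).obj k) : act (F ◁ f) (pure F G a b) = pure F H a (act f b) :=
  app_congr (A := F.functor.obj x ⊗ G.functor.obj y)
    (convolutionExtensionUnit_comp_ι_map_whiskerLeft_app (C := InjCat) SSet.{u} F f x y) (pair a b)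

lemma act_whiskerRight (f : F ⟶ G) {x y : InjCat} (a : (F.functor.obj x).obj k)
    (b : (H.functor.obj y).obj k) : act (f ▷ H) (pure F H a b) = pure G H (act f a) b :=
  app_congr (A := F.functor.obj x ⊗ H.functor.obj y)
    (convolutionExtensionUnit_comp_ι_map_whiskerRight_app InjCat SSet.{u} f H x y) (pair a b)

/-- The regrouped product simplex lives over `x ⊔ (y ⊔ z)`; the inverse associator of `InjCat`
brings it back to the level `(x ⊔ y) ⊔ z` of the source. The shuffle in `act_braiding` has the same
role. -/
lemma act_associator {x y z : InjCat} (a : (F.functor.obj x).obj k)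
    (b : (G.functor.obj y).obj k) (c : (H.functor.obj z).obj k) :
    act (α_ F G H).hom (pure (F ⊗ G) H (pure F G a b) c) =
      push (F ⊗ G ⊗ H) (α_ x y z).inv (pure F (G ⊗ H) a (pure G H b c)) :=
  app_congr (A := (F.functor.obj x ⊗ G.functor.obj y) ⊗ H.functor.obj z)
    (associator_hom_unit_unit (C := InjCat) SSet.{u} F G H x y z) (pair (pair a b) c)

lemma act_braiding {x y : InjCat} (a : (F.functor.obj x).obj k)
    (b : (G.functor.obj y).obj k) :
    act (β_ F G).hom (pure F G a b) = push (G ⊗ F) (β_ y x).hom (pure G F b a) :=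
  app_congr (A := F.functor.obj x ⊗ G.functor.obj y)
    (DaySymmetric.η_braiding F G x y) (pair a b)

lemma act_tensorDesc (f : F.functor ⊠ G.functor ⟶ tensor InjCat ⋙ H.functor) {x y : InjCat}
    (a : (F.functor.obj x).obj k) (b : (G.functor.obj y).obj k) :
    act (tensorDesc f) (pure F G a b) = (f.app (x, y)).app k (a, b) :=
  app_congr (A := F.functor.obj x ⊗ G.functor.obj y)
    (η_comp_tensorDesc_app f x y) (pair a b)

end DayElements

/-! ### The equivariant map from the tensor power to injective words -/

namespace InjPow

open DayElements Codisc
open scoped ExternalProduct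

/-- The functor of points in a finite set. -/
def points : InjCat ⥤ Type u where
  obj m := ULift (Fin m.card)
  map {m m'} f := ↾fun i => ⟨(show Fin m.card ↪ Fin m'.card from f) i.down⟩

/-- The functor `I(n, -)`. -/
def words (n : ℕ) : InjCat ⥤ Type u where
  obj m := ULift (Fin n ↪ Fin m.card)
  map f := ↾fun w => ⟨w.down.trans f⟩

/-- The word `a w` in the concatenation of two sets. -/
def cons {x y n : ℕ} (a : Fin x) (w : Fin n ↪ Fin y) : Fin (n + 1) ↪ Fin (x + y) where
  toFun := Fin.cases (Fin.castAdd y a) (fun i => Fin.natAdd x (w i))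
  inj' i j h := by
    -- Letters from different blocks of a concatenation differ. This keeps words free of
    -- repetitions, and is the source of freeness.
    have hne (j : Fin y) : Fin.castAdd y a ≠ Fin.natAdd x j := fun h => by
      have := congrArg Fin.val h
      simp only [Fin.val_castAdd, Fin.val_natAdd] at this
      omega
    cases i using Fin.cases with
    | zero =>
      cases j using Fin.cases with
      | zero => rfl
      | succ j => exact (hne _ h).elim
    | succ i =>
      cases j using Fin.cases with
      | zero => exact (hne _ h.symm).elim
      | succ j => exact congrArg Fin.succ (w.injective (Fin.natAdd_injective _ _ h))

lemma cons_zero {x y n : ℕ} (a : Fin x) (w : Fin n ↪ Fin y) :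
    cons a w 0 = Fin.castAdd y a := rfl

lemma cons_succ {x y n : ℕ} (a : Fin x) (w : Fin n ↪ Fin y) (i : Fin n) :
    cons a w i.succ = Fin.natAdd x (w i) := rfl

lemma cons_concat {x x' y y' n : ℕ} (a : Fin x) (w : Fin n ↪ Fin y) (f : Fin x ↪ Fin x')
    (g : Fin y ↪ Fin y') : cons (f a) (w.trans g) = (cons a w).trans (InjCat.concat f g) := by
  ext i
  cases i using Fin.cases <;> simp [cons_zero, cons_succ]

/-- The diagram of codiscrete simplicial sets on the sets `I(n, m)`. -/
def W (n : ℕ) : DayFunctor InjCat SSet.{u} := .mk (words n ⋙ codisc)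

/-- The words that are the vertices of a simplex. -/
def wordAt {n : ℕ} {m : InjCat} {k : SimplexCategoryᵒᵖ} (p : ((W.{u} n).functor.obj m).obj k)
    (i : Fin (k.unop.len + 1)) : Fin n ↪ Fin m.card :=
  (coord (S := (words n).obj m) p i).down

lemma wordAt_ext {n : ℕ} {m : InjCat} {k : SimplexCategoryᵒᵖ}
    {p q : ((W.{u} n).functor.obj m).obj k} (h : ∀ i, wordAt p i = wordAt q i) : p = q :=
  funext fun i => congrArg ULift.up (h i)

lemma wordAt_push {n : ℕ} {m m' : InjCat} (f : m ⟶ m') {k : SimplexCategoryᵒᵖ}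
    (p : ((W.{u} n).functor.obj m).obj k) (i : Fin (k.unop.len + 1)) :
    wordAt (push (W n) f p) i = (wordAt p i).trans f := rfl

/-- The permutation `σ` acts on `I(n, -)` by precomposition with `σ⁻¹`. -/
def wordsPerm (n : ℕ) (σ : Equiv.Perm (Fin n)) : words.{u} n ⟶ words n where
  app m := ↾fun w => ⟨σ⁻¹.toEmbedding.trans w.down⟩

/-- The action of a permutation on the diagram `W n`. -/
def WPerm (n : ℕ) (σ : Equiv.Perm (Fin n)) : W.{u} n ⟶ W n :=
  .mk (Functor.whiskerRight (wordsPerm n σ) codisc)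

lemma wordAt_WPerm {n : ℕ} (σ : Equiv.Perm (Fin n)) {m : InjCat} {k : SimplexCategoryᵒᵖ}
    (p : ((W.{u} n).functor.obj m).obj k) (i : Fin (k.unop.len + 1)) :
    wordAt (act (WPerm n σ) p) i = σ⁻¹.toEmbedding.trans (wordAt p i) := rfl

variable {X : InjCat ⥤ SSet.{u}} (φ : X ⟶ points ⋙ codisc)

/-- Adding a letter to a word. -/
noncomputable def consHom (n : ℕ) : DayFunctor.mk X ⊗ W n ⟶ W (n + 1) :=
  DayFunctor.tensorDesc
    { app xy := 
        { app k := ↾fun ab i => 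
            ⟨cons (coord ((φ.app xy.1).app k ab.1) i).down (coord (S := (words n).obj xy.2) ab.2 i).down⟩
          naturality k l f := by
            ext ab
            funext i
            have := ConcreteCategory.congr_hom ((φ.app xy.1).naturality f) ab.1
            exact congrArg (fun t => (⟨cons (coord t i).down
              (coord (S := (words n).obj xy.2) ab.2 (f.unop.toOrderHom i)).down⟩ :
                ULift (Fin (n + 1) ↪ Fin (xy.1.card + xy.2.card)))) this }
      naturality xy xy' f := by
        ext k ab
        funext i
        -- Naturality of `φ` moves the first letter along `f.1`; `cons_concat` then treats the whole
        -- word.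
        have := ConcreteCategory.congr_hom (NatTrans.congr_app (φ.naturality f.1) k) ab.1
        refine (congrArg (fun t => (⟨cons (coord t i).down
              ((coord (S := (words n).obj xy.2) ab.2 i).down.trans f.2)⟩ :
                ULift (Fin (n + 1) ↪ Fin (xy'.1.card + xy'.2.card)))) this).trans ?_
        exact congrArg ULift.up (cons_concat _ _ _ _) }

/-- The points that are the vertices of the image of a simplex. -/
def pointAt {x : InjCat} {k : SimplexCategoryᵒᵖ} (a : (X.obj x).obj k)
    (i : Fin (k.unop.len + 1)) : Fin x.card :=
  (coord (S := points.obj x) ((φ.app x).app k a) i).down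

lemma wordAt_consHom {n : ℕ} {x y : InjCat} {k : SimplexCategoryᵒᵖ} (a : (X.obj x).obj k)
    (b : ((W.{u} n).functor.obj y).obj k) (i : Fin (k.unop.len + 1)) :
    wordAt (act (consHom φ n) (pure (.mk X) (W n) a b)) i = cons (pointAt φ a i) (wordAt b i) := by
  rw [consHom, act_tensorDesc]
  rfl

/-- The added letter sits in position `0`, which the shifted permutation fixes. -/
lemma consHom_WPerm (n : ℕ) (σ : Equiv.Perm (Fin n)) :
    (DayFunctor.mk X ◁ WPerm n σ) ≫ consHom φ n =
      consHom φ n ≫ WPerm (n + 1) (Tower.permShift n σ) := by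
  refine hom_ext_pure fun x y k a b => wordAt_ext fun i => ?_
  rw [act_comp, act_comp, act_whiskerLeft, wordAt_WPerm]
  erw [wordAt_consHom, wordAt_consHom]
  rw [wordAt_WPerm, ← map_inv]
  ext j
  cases j using Fin.cases with
  | zero =>
    change _ = (cons _ (wordAt b i) (Tower.permShift n σ⁻¹ 0)).val
    rw [Tower.permShift_zero]
    rfl
  | succ j =>
    change _ = (cons (pointAt φ a i) (wordAt b i) (Tower.permShift n σ⁻¹ j.succ)).val
    rw [Tower.permShift_succ]
    rfl

/-- The block shuffle returns `a` and `b` to their blocks in `x ⊔ y` but does not change the order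
in which the word lists them. The casts are the associators hidden in `swapFront`. -/
lemma cons_cons_swap {x y z n : ℕ} (a : Fin x) (b : Fin y) (w : Fin n ↪ Fin z) :
    ((cons b (cons a w)).trans (finCongr (Nat.add_assoc y x z).symm).toEmbedding).trans
      (InjCat.concat finAddFlip.toEmbedding (Function.Embedding.refl (Fin z))) =
    ((Equiv.swap (0 : Fin (n + 2)) 1).toEmbedding.trans
      (cons a (cons b w))).trans (finCongr (Nat.add_assoc x y z).symm).toEmbedding := by
  ext i
  simp only [Function.Embedding.trans_apply, Equiv.coe_toEmbedding, finCongr_apply]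
  cases i using Fin.cases with
  | zero =>
    rw [Equiv.swap_apply_left, cons_zero, InjCat.castAdd_symm, InjCat.concat_castAdd]
    simp only [Equiv.coe_toEmbedding, finAddFlip_apply_castAdd]
    rfl
  | succ i =>
    cases i using Fin.cases with
    | zero =>
      rw [cons_succ, cons_zero, InjCat.natAdd_castAdd_symm, InjCat.concat_castAdd]
      simp only [Equiv.coe_toEmbedding, finAddFlip_apply_natAdd]
      change _ = (Fin.cast _ (cons a (cons b w) (Equiv.swap 0 1 1))).val
      rw [Equiv.swap_apply_right]
      rfl
    | succ i =>
      rw [Equiv.swap_apply_of_ne_of_ne (b := 1) (Fin.succ_ne_zero _)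
        (fun h => Fin.succ_ne_zero _ (Fin.succ_injective _ h)), cons_succ, cons_succ, cons_succ,
        cons_succ, InjCat.natAdd_natAdd_symm, InjCat.natAdd_natAdd_symm, InjCat.concat_natAdd]
      rfl

/-- On product simplices of three factors this reduces, vertex by vertex, to `cons_cons_swap`. -/
lemma swapFront_consHom (n : ℕ) :
    (SymPow.swapFront (DayFunctor.mk X) (W n)).hom ≫ (DayFunctor.mk X ◁ consHom φ n) ≫
        consHom φ (n + 1) =
      (DayFunctor.mk X ◁ consHom φ n) ≫ consHom φ (n + 1) ≫ WPerm (n + 2) (Equiv.swap 0 1) := by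
  -- Rebracketing the source cancels the inverse associator at the start of `swapFront`, so that the
  -- braiding acts directly on the factor `X ⊗ X`.
  rw [← cancel_epi (α_ _ _ _).hom]
  simp only [SymPow.swapFront, Iso.trans_hom, Iso.symm_hom, whiskerRightIso_hom, Category.assoc,
    Iso.hom_inv_id_assoc]
  refine hom_ext_pure fun w z k c b => ?_
  obtain ⟨x, y, i, a, a', rfl⟩ := exists_pure c
  rw [pure_push_left, act_push, act_push]
  congr 1
  simp only [act_comp, act_whiskerRight, act_braiding, act_associator, act_whiskerLeft, act_push,
    pure_push_left]
  refine wordAt_ext fun i => ?_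
  rw [wordAt_push, wordAt_push, wordAt_push, wordAt_WPerm]
  erw [wordAt_consHom, wordAt_consHom, wordAt_consHom, wordAt_consHom]
  exact cons_cons_swap _ _ _

/-- The map from the tensor power of `X` to the diagram of words that forms words from the points
given by the factors. -/
noncomputable def powHom : (n : ℕ) → SymPow.tpow (DayFunctor.mk X) n ⟶ W.{u} n
  | 0 => .mk
    { app _ := Codisc.lift fun _ => ⟨Function.Embedding.ofIsEmpty⟩
      naturality _ _ _ := Codisc.hom_ext fun _ =>
        congrArg ULift.up (Function.Embedding.ext fun i => i.elim0) }
  | n + 1 => DayFunctor.mk X ◁ powHom n ≫ consHom φ n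

/-- Equivariance for the generators, by induction on the number of factors. The first transposition
slides past the map on the remaining factors by `swapFront_nat` and is handled by
`swapFront_consHom`; a later one is a shift, handled by `consHom_WPerm`. -/
lemma adj_powHom (n : ℕ) (i : Fin n) :
    (SymPow.adj (DayFunctor.mk X) n i).hom ≫ powHom φ (n + 1) =
      powHom φ (n + 1) ≫ WPerm (n + 1) (Equiv.swap i.castSucc i.succ) := by
  induction n with
  | zero => exact i.elim0
  | succ n ih =>
    cases i using Fin.cases with
    | zero =>
      change (SymPow.swapFront (DayFunctor.mk X) (SymPow.tpow _ n)).hom ≫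
        DayFunctor.mk X ◁ (DayFunctor.mk X ◁ powHom φ n ≫ consHom φ n) ≫ consHom φ (n + 1) =
        (DayFunctor.mk X ◁ (DayFunctor.mk X ◁ powHom φ n ≫ consHom φ n) ≫ consHom φ (n + 1)) ≫
          WPerm (n + 2) (Equiv.swap 0 1)
      rw [MonoidalCategory.whiskerLeft_comp, Category.assoc,
        ← Category.assoc (SymPow.swapFront _ _).hom, SymPow.swapFront_nat]
      simp only [Category.assoc, swapFront_consHom]
    | succ j =>
      change DayFunctor.mk X ◁ (SymPow.adj (DayFunctor.mk X) n j).hom ≫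
        DayFunctor.mk X ◁ powHom φ (n + 1) ≫ consHom φ (n + 1) =
        (DayFunctor.mk X ◁ powHom φ (n + 1) ≫ consHom φ (n + 1)) ≫
          WPerm (n + 2) (Equiv.swap j.succ.castSucc j.succ.succ)
      rw [← MonoidalCategory.whiskerLeft_comp_assoc, ih, MonoidalCategory.whiskerLeft_comp,
        Category.assoc, consHom_WPerm, Tower.permShift_swap, Category.assoc]
      rfl

lemma WPerm_one (n : ℕ) : WPerm.{u} n 1 = 𝟙 _ := rfl

/-- Precomposition with inverses is a left action; the order of composition matches the convention
for products in `Aut`. -/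
lemma WPerm_mul (n : ℕ) (σ τ : Equiv.Perm (Fin n)) :
    WPerm.{u} n (σ * τ) = WPerm n τ ≫ WPerm n σ := by
  refine DayElements.hom_ext fun m k p => wordAt_ext fun i => ?_
  rw [act_comp, wordAt_WPerm, wordAt_WPerm, wordAt_WPerm, mul_inv_rev]
  rfl

/-- Both sides are compatible with products of permutations, and the adjacent transpositions
generate the symmetric group. -/
lemma permHom_powHom (n : ℕ) (σ : Equiv.Perm (Fin n)) :
    (SymPow.permHom (DayFunctor.mk X) n σ).hom ≫ powHom φ n = powHom φ n ≫ WPerm n σ := by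
  cases n with
  | zero =>
    obtain rfl := Subsingleton.elim σ 1
    rw [map_one, WPerm_one, Category.comp_id]
    exact Category.id_comp _
  | succ n =>
    have hσ : σ ∈ Submonoid.closure (Set.range fun i : Fin n => Equiv.swap i.castSucc i.succ) := by
      rw [Equiv.Perm.mclosure_swap_castSucc_succ]
      trivial
    induction hσ using Submonoid.closure_induction with
    | mem _ h =>
      obtain ⟨i, rfl⟩ := h
      rw [SymPow.permHom_swap, adj_powHom]
    | one =>
      rw [map_one, WPerm_one, Category.comp_id]
      exact Category.id_comp _
    | mul σ τ _ _ hσ hτ =>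
      rw [map_mul, WPerm_mul, ← Category.assoc, ← hτ, Category.assoc, ← hσ]
      exact Category.assoc _ _ _

/-- Only the identity fixes a simplex of the tensor power. -/
lemma eq_one_of_act_permHom_eq (φ : X ⟶ points ⋙ codisc) {n : ℕ} {m : InjCat} {k : SimplexCategoryᵒᵖ}
    {x : ((SymPow.tpow (DayFunctor.mk X) n).functor.obj m).obj k} {σ : Equiv.Perm (Fin n)}
    (h : act (SymPow.permHom (DayFunctor.mk X) n σ).hom x = x) : σ = 1 := by
  have key : act (powHom φ n) x = act (WPerm n σ) (act (powHom φ n) x) := by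
    rw [← act_comp, ← permHom_powHom, act_comp, h]
  -- A single vertex suffices: its word `w` satisfies `w = w ∘ σ⁻¹`, and injectivity of `w` gives
  -- `σ⁻¹ = 1`.
  have hw := (congrArg (fun p => wordAt p 0) key).trans (wordAt_WPerm _ _ _)
  rw [← inv_eq_one]
  ext i
  exact congrArg Fin.val ((wordAt _ 0).injective (DFunLike.congr_fun hw i)).symm

end InjPow

theorem lemma2p9 (X : InjCat ⥤ SSet.{u}) (hX : IDiagram.IsPosICofibrant X) (n : ℕ)
    (m : InjCat) : IDiagram.IsFreeAction (IDiagram.boxPowAction X n m) := by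
  -- The element `0` of `Fin n.card` exists exactly because the level is positive.
  obtain ⟨φ⟩ := Codisc.nonempty_hom hX InjPow.points fun n hn => ⟨⟨⟨0, hn⟩⟩⟩
  exact fun k x σ hx => InjPow.eq_one_of_act_permHom_eq φ hx
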